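/- Let $\Lambda$ be a left hereditary ring (an associative ring with identity all of whose left ideals are projective), and let $\Lambda\text{-}\underline{\mathrm{Mod}}$ be its stable category: the objects are all left $\Lambda$-modules, and the morphisms are $\Lambda$-homomorphisms modulo those that factor through a projective module. A monomorphism in this category is called normal if it is a kernel of some morphism. Then every monomorphism in $\Lambda\text{-}\underline{\mathrm{Mod}}$ is normal if and only if the injective envelope of $_\Lambda\Lambda$ is projective. Moreover, if $P$ is a projective left $\Lambda$-module with injective envelope $P\to I$ and $I$ is not projective, then the class of the canonical projection $I\to I/P$ is a non-normal monomorphism in $\Lambda\text{-}\underline{\mathrm{Mod}}$. -/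

import Mathlib

open CategoryTheory

universe u

namespace StableModule

/-- A ring is left hereditary if each of its left ideals is a projective left module.
(For a noncommutative ring, Mathlib's `Ideal` means left ideal.) -/
def IsLeftHereditary (Λ : Type u) [Ring Λ] : Prop :=
  ∀ J : Ideal Λ, Module.Projective Λ J

/-- `i : M → E` is an injective envelope: `i` is a monomorphism into an injective module, and
the extension is essential. -/
structure IsInjectiveEnvelope {Λ : Type u} [Ring Λ] {M E : Type u} [AddCommGroup M] [Module Λ M]
    [AddCommGroup E] [Module Λ E] (i : M →ₗ[Λ] E) : Prop where
  injective_map : Function.Injective i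
  injective_module : Module.Injective Λ E
  essential : ∀ N : Submodule Λ E, N ⊓ LinearMap.range i = ⊥ → N = ⊥

variable (Λ : Type u) [Ring Λ]

/-- The homomorphism `f` factors through a projective module. -/
def FactorsThroughProjective {A B : ModuleCat.{u} Λ} (f : A ⟶ B) : Prop :=
  ∃ P : ModuleCat.{u} Λ, Module.Projective Λ P ∧ ∃ (g : A ⟶ P) (h : P ⟶ B), g ≫ h = f

/-- Two homomorphisms are equivalent if their difference factors through a projective. -/
def stableRel : HomRel (ModuleCat.{u} Λ) :=
  fun _ _ f g => FactorsThroughProjective Λ (f - g)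

variable {Λ}

theorem FactorsThroughProjective.zero (A B : ModuleCat.{u} Λ) :
    FactorsThroughProjective Λ (0 : A ⟶ B) :=
  ⟨ModuleCat.of Λ PUnit, inferInstance, 0, 0, by simp⟩

theorem FactorsThroughProjective.neg {A B : ModuleCat.{u} Λ} {f : A ⟶ B}
    (hf : FactorsThroughProjective Λ f) : FactorsThroughProjective Λ (-f) := by
  obtain ⟨P, hP, g, h, rfl⟩ := hf
  exact ⟨P, hP, g, -h, by simp⟩

theorem FactorsThroughProjective.add {A B : ModuleCat.{u} Λ} {f f' : A ⟶ B}
    (hf : FactorsThroughProjective Λ f) (hf' : FactorsThroughProjective Λ f') :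
    FactorsThroughProjective Λ (f + f') := by
  obtain ⟨P, hP, g, h, rfl⟩ := hf
  obtain ⟨P', hP', g', h', rfl⟩ := hf'
  refine ⟨ModuleCat.of Λ (P × P'), inferInstanceAs (Module.Projective Λ (P × P')),
    ModuleCat.ofHom (g.hom.prod g'.hom), ModuleCat.ofHom (h.hom.coprod h'.hom), ?_⟩
  ext x
  simp

theorem FactorsThroughProjective.comp_left {A B C : ModuleCat.{u} Λ} (k : A ⟶ B) {f : B ⟶ C}
    (hf : FactorsThroughProjective Λ f) : FactorsThroughProjective Λ (k ≫ f) := by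
  obtain ⟨P, hP, g, h, rfl⟩ := hf
  exact ⟨P, hP, k ≫ g, h, by simp⟩

theorem FactorsThroughProjective.comp_right {A B C : ModuleCat.{u} Λ} {f : A ⟶ B} (k : B ⟶ C)
    (hf : FactorsThroughProjective Λ f) : FactorsThroughProjective Λ (f ≫ k) := by
  obtain ⟨P, hP, g, h, rfl⟩ := hf
  exact ⟨P, hP, g, h ≫ k, by simp⟩

variable (Λ)

instance stableRel_congruence : Congruence (stableRel Λ) where
  equivalence :=
    { refl := fun f => by
        simpa [stableRel] using FactorsThroughProjective.zero _ _
      symm := fun {f g} h => by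
        have := FactorsThroughProjective.neg h
        rwa [neg_sub] at this
      trans := fun {f g k} h h' => by
        have := FactorsThroughProjective.add h h'
        rwa [sub_add_sub_cancel] at this }
  comp_left := fun k _ _ h => by
    have := FactorsThroughProjective.comp_left k h
    rwa [Preadditive.comp_sub] at this
  comp_right := fun k h => by
    have := FactorsThroughProjective.comp_right k h
    rwa [Preadditive.sub_comp] at this

theorem stableRel_add ⦃A B : ModuleCat.{u} Λ⦄ (f₁ f₂ g₁ g₂ : A ⟶ B)
    (hf : stableRel Λ f₁ f₂) (hg : stableRel Λ g₁ g₂) :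
    stableRel Λ (f₁ + g₁) (f₂ + g₂) := by
  have := FactorsThroughProjective.add hf hg
  rwa [sub_add_sub_comm] at this

/-- The (projectively) stable category of left `Λ`-modules: its objects are all left `Λ`-modules,
and its morphisms are the homomorphisms modulo those that factor through a projective. -/
abbrev StableCategory : Type (u + 1) := CategoryTheory.Quotient (stableRel Λ)

/-- Addition of morphisms in the stable category is induced by addition of homomorphisms. -/
noncomputable instance stablePreadditive : Preadditive (StableCategory Λ) :=
  Quotient.preadditive (stableRel Λ) (stableRel_add Λ)

/-- The quotient functor from modules to the stable category. -/
abbrev quotientFunctor : ModuleCat.{u} Λ ⥤ StableCategory Λ :=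
  Quotient.functor (stableRel Λ)

/-- A homomorphism is zero in the stable category exactly when it factors through a projective. -/
theorem quotientFunctor_map_eq_zero_iff {A B : ModuleCat.{u} Λ} (f : A ⟶ B) :
    (quotientFunctor Λ).map f = 0 ↔ FactorsThroughProjective Λ f := by
  have h := Quotient.functor_map_eq_iff (stableRel Λ) f 0
  rw [stableRel, sub_zero] at h
  exact h

end StableModule

/-!
Over a left hereditary ring, quotients of injective modules are injective and submodules of
projective modules are projective.

In the stable category a homomorphism `f : X → A` may be made surjective by adding a projective
summand to `X`, and it is then a monomorphism exactly when its kernel `K` is projective. Being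
a kernel amounts to the extension of `A` by `K` being pulled back from one with projective middle
term, that is, to a homomorphism from the enlarged `X` to a projective module which is injective on
`K`. If `X = I` is an injective envelope of `K = P`, such a homomorphism is injective on all
of `I`, so `I` is projective; this is `IsLeftHereditary.isEmpty_normalMono_mkQ_range`, and it gives
one direction of the equivalence for `P = Λ`. Conversely, if `K` embeds in a module that is both
projective and injective, the embedding extends to `X`, and `f` is a kernel
(`IsLeftHereditary.nonempty_normalMono`).

It remains to embed every projective module in a projective injective one when the envelope `E` of
`Λ` is projective. Every free module embeds in a direct sum of copies of `E`, so it suffices that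
these direct sums are injective, for which `Λ` being left Noetherian is enough. A finitely generated
essential submodule of a projective module forces the module to be finitely generated
(`IsLeftHereditary.finite_of_essential_fg`). Hence `E` is finitely generated, and a left ideal that
is not finitely generated contains an infinite direct sum of nonzero left ideals. The latter
is impossible inside `E`, by a diagonal argument in the style of Osofsky's theorem on rings
with injective cyclic modules (`IsLeftHereditary.false_of_idempotents`): all
quotients of `E` are injective, and `E` is finitely generated and projective.
-/

namespace StableModule

/-! ### Essential submodules and hereditary rings -/

section Essential

variable {Λ : Type u} [Ring Λ]

/-- A submodule is essential if it meets every nonzero submodule nontrivially. -/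
def IsEssential {M : Type u} [AddCommGroup M] [Module Λ M] (N : Submodule Λ M) : Prop :=
  ∀ N' : Submodule Λ M, N' ⊓ N = ⊥ → N' = ⊥

variable {M E F S P Q : Type u} [AddCommGroup M] [Module Λ M] [AddCommGroup E] [Module Λ E]
  [AddCommGroup F] [Module Λ F] [AddCommGroup S] [Module Λ S] [AddCommGroup P] [Module Λ P]
  [AddCommGroup Q] [Module Λ Q]

theorem IsEssential.injective_of_comp {i : M →ₗ[Λ] E} (hi : IsEssential (LinearMap.range i))
    {f : E →ₗ[Λ] F} (hf : Function.Injective (f ∘ₗ i)) : Function.Injective f := by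
  refine LinearMap.ker_eq_bot.mp (hi _ ?_)
  rw [eq_bot_iff]
  rintro _ ⟨hx, m, rfl⟩
  have : m = 0 := hf (by simpa using hx)
  simp [this]

/-- By Zorn's lemma, take `C` maximal among the submodules of `E` disjoint from `range i`. -/
theorem exists_essential_quotient (i : M →ₗ[Λ] E) (hi : Function.Injective i) :
    ∃ C : Submodule Λ E, Function.Injective (C.mkQ ∘ₗ i) ∧
      IsEssential (LinearMap.range (C.mkQ ∘ₗ i)) := by
  obtain ⟨C, -, hC⟩ := zorn_le_nonempty₀ {C : Submodule Λ E | Disjoint C (LinearMap.range i)}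
    (fun c hc hch y hy => ⟨sSup c, by
      refine Submodule.disjoint_def.mpr fun x hx hxi => ?_
      obtain ⟨D, hD, hxD⟩ := (Submodule.mem_sSup_of_directed ⟨y, hy⟩ hch.directedOn).mp hx
      exact Submodule.disjoint_def.mp (hc hD) x hxD hxi, fun z hz => le_sSup hz⟩)
    ⊥ disjoint_bot_left
  have hdis := Submodule.disjoint_def.mp hC.prop
  refine ⟨C, ?_, fun N hN => ?_⟩
  · refine (injective_iff_map_eq_zero _).mpr fun m hm => hi ?_
    rw [map_zero]
    exact hdis _ (by simpa using hm) ⟨m, rfl⟩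
  · have hle : N.comap C.mkQ ≤ C := by
      refine hC.le_of_ge (y := N.comap C.mkQ) (Submodule.disjoint_def.mpr ?_) ?_
      · rintro _ hx ⟨m, rfl⟩
        have : C.mkQ (i m) ∈ N ⊓ LinearMap.range (C.mkQ ∘ₗ i) := ⟨hx, m, rfl⟩
        rw [hN] at this
        exact hdis _ (by simpa using this) ⟨m, rfl⟩
      · intro x hx
        have : C.mkQ x = 0 := by simpa using hx
        simp [Submodule.mem_comap, this]
    rw [eq_bot_iff]
    intro x hx
    obtain ⟨y, rfl⟩ := C.mkQ_surjective x
    simpa using hle hx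

theorem exists_injective_embedding (M : Type u) [AddCommGroup M] [Module Λ M] :
    ∃ (E : ModuleCat.{u} Λ) (i : M →ₗ[Λ] E), Function.Injective i ∧ Module.Injective Λ E := by
  refine ⟨Injective.under (ModuleCat.of Λ M), (Injective.ι (ModuleCat.of Λ M)).hom, ?_, ?_⟩
  · exact (ModuleCat.mono_iff_injective _).mp inferInstance
  · exact (Module.injective_iff_injective_object Λ _).mpr
      (inferInstanceAs (Injective (Injective.under (ModuleCat.of Λ M))))

/-- Baer's criterion: a homomorphism from a left ideal lifts along `q`, since the ideal is
projective. -/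
theorem IsLeftHereditary.injective_of_surjective (hΛ : IsLeftHereditary Λ)
    (hE : Module.Injective Λ E) (q : E →ₗ[Λ] Q) (hq : Function.Surjective q) :
    Module.Injective Λ Q := by
  refine Module.Baer.injective fun J g => ?_
  have := hΛ J
  obtain ⟨g', hg'⟩ := Module.projective_lifting_property q g hq
  obtain ⟨h, hh⟩ := Module.Baer.of_injective hE J g'
  exact ⟨q ∘ₗ h, fun x mem => by simp [hh x mem, ← hg']⟩

/-- Every module has an injective envelope; over a left hereditary ring it can be taken as a
quotient of an arbitrary injective extension, as such quotients are injective. -/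
theorem IsLeftHereditary.exists_isInjectiveEnvelope (hΛ : IsLeftHereditary Λ)
    (M : Type u) [AddCommGroup M] [Module Λ M] :
    ∃ (E : ModuleCat.{u} Λ) (i : M →ₗ[Λ] E), IsInjectiveEnvelope i := by
  obtain ⟨E, i, hi, hE⟩ := exists_injective_embedding (Λ := Λ) M
  obtain ⟨C, hinj, hess⟩ := exists_essential_quotient i hi
  exact ⟨ModuleCat.of Λ (E ⧸ C), C.mkQ ∘ₗ i, hinj,
    hΛ.injective_of_surjective hE C.mkQ C.mkQ_surjective, hess⟩

/-- Submodules of projectives are projective. To split a surjection `f : (S →₀ Λ) → S`, embed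
`S →₀ Λ` into an injective `E`. The quotient `E / ker f` is again injective, so the
map `S → E / ker f` extends to `P` and then lifts to `E`. -/
theorem IsLeftHereditary.projective_of_injective (hΛ : IsLeftHereditary Λ)
    (hP : Module.Projective Λ P) (i : S →ₗ[Λ] P) (hi : Function.Injective i) :
    Module.Projective Λ S := by
  refine Module.Projective.of_lifting_property'' fun f hf => ?_
  obtain ⟨E, j, hj, hE⟩ := exists_injective_embedding (Λ := Λ) (S →₀ Λ)
  let N : Submodule Λ E := (LinearMap.ker f).map j
  let g : S →ₗ[Λ] E ⧸ N :=
    (Submodule.mapQ (LinearMap.ker f) N j (Submodule.le_comap_map _ _)) ∘ₗ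
      (f.quotKerEquivOfSurjective hf).symm.toLinearMap
  have hg : ∀ y, g (f y) = N.mkQ (j y) := fun y => by
    have : (f.quotKerEquivOfSurjective hf).symm (f y) = (LinearMap.ker f).mkQ y := by
      rw [LinearEquiv.symm_apply_eq]; rfl
    simp only [g, LinearMap.comp_apply, LinearEquiv.coe_coe, this]
    rfl
  obtain ⟨g', hg'⟩ :=
    (hΛ.injective_of_surjective hE N.mkQ N.mkQ_surjective).out i hi g
  obtain ⟨t, ht⟩ := Module.projective_lifting_property N.mkQ g' N.mkQ_surjective
  have key : ∀ y, ∃ z ∈ LinearMap.ker f, j z = t (i (f y)) - j y := fun y => by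
    have : N.mkQ (t (i (f y)) - j y) = 0 := by
      rw [map_sub, ← hg, ← hg', ← ht]; simp
    have := (Submodule.Quotient.mk_eq_zero N).mp this
    simpa [N] using this
  have hmem : ∀ s, t (i s) ∈ LinearMap.range j := fun s => by
    obtain ⟨y, rfl⟩ := hf s
    obtain ⟨z, -, hz⟩ := key y
    exact ⟨z + y, by rw [map_add, hz]; abel⟩
  let h : S →ₗ[Λ] (S →₀ Λ) :=
    (LinearEquiv.ofInjective j hj).symm.toLinearMap ∘ₗ
      (t ∘ₗ i).codRestrict (LinearMap.range j) hmem
  have hh : ∀ s, j (h s) = t (i s) := fun s => by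
    have := congrArg Subtype.val ((LinearEquiv.ofInjective j hj).apply_symm_apply
      ((t ∘ₗ i).codRestrict (LinearMap.range j) hmem s))
    exact this
  refine ⟨h, LinearMap.ext fun s => ?_⟩
  obtain ⟨y, rfl⟩ := hf s
  obtain ⟨z, hz, hz'⟩ := key y
  have : h (f y) = z + y := hj (by rw [hh, map_add, hz']; abel)
  simp [this, LinearMap.mem_ker.mp hz]

/-- The kernel is a direct summand, since the range is projective; an essential direct summand
is everything. -/
theorem IsLeftHereditary.eq_zero_of_essential_ker (hΛ : IsLeftHereditary Λ)
    (hF : Module.Projective Λ F) (f : M →ₗ[Λ] F) (hf : IsEssential (LinearMap.ker f)) :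
    f = 0 := by
  have : Module.Projective Λ (LinearMap.range f) :=
    hΛ.projective_of_injective hF (LinearMap.range f).subtype Subtype.val_injective
  obtain ⟨s, hs⟩ := Module.projective_lifting_property f.rangeRestrict LinearMap.id
    f.surjective_rangeRestrict
  have hs' : ∀ y, f (s y) = y := fun y => congrArg Subtype.val (LinearMap.congr_fun hs y)
  have hbot : LinearMap.range s = ⊥ := by
    refine hf _ (eq_bot_iff.mpr ?_)
    rintro _ ⟨⟨y, rfl⟩, hy⟩
    have : y = 0 := Subtype.ext (by rw [← hs' y]; exact hy)
    simp [this]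
  ext x
  have h0 : s (f.rangeRestrict x) = 0 := by
    have : s (f.rangeRestrict x) ∈ LinearMap.range s := ⟨_, rfl⟩
    rwa [hbot] at this
  have := hs' (f.rangeRestrict x)
  rw [h0, map_zero] at this
  simpa using this.symm

theorem IsEssential.mono {N N' : Submodule Λ M} (hN : IsEssential N) (h : N ≤ N') :
    IsEssential N' :=
  fun K hK => hN K (eq_bot_iff.mpr ((inf_le_inf_left K h).trans hK.le))

theorem exists_finset_le_supported {ι : Type u} (N : Submodule Λ (ι →₀ E)) (hN : N.FG) :
    ∃ T : Finset ι, N ≤ Finsupp.supported E Λ (T : Set ι) := by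
  classical
  induction N, hN using Submodule.fg_induction with
  | singleton x =>
    exact ⟨x.support, by
      rw [Submodule.span_singleton_le_iff_mem, Finsupp.mem_supported]⟩
  | sup N₁ N₂ _ _ h₁ h₂ =>
    obtain ⟨T₁, h₁⟩ := h₁
    obtain ⟨T₂, h₂⟩ := h₂
    refine ⟨T₁ ∪ T₂, sup_le (h₁.trans ?_) (h₂.trans ?_)⟩ <;>
      exact Finsupp.supported_mono (by simp)

/-- Write `P` as a direct summand of `P →₀ Λ`. A finitely generated submodule involves only
finitely many coordinates, and the remaining coordinates vanish on it, hence on all of `P` when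
it is essential. -/
theorem IsLeftHereditary.finite_of_essential_fg (hΛ : IsLeftHereditary Λ)
    (hP : Module.Projective Λ P) (N : Submodule Λ P) (hN : N.FG) (hess : IsEssential N) :
    Module.Finite Λ P := by
  obtain ⟨s, hs⟩ := Module.projective_def'.mp hP
  obtain ⟨T, hT⟩ := exists_finset_le_supported (N.map s) (hN.map s)
  let q : P →ₗ[Λ] ({x : P // x ∉ T} →₀ Λ) := Finsupp.lsubtypeDomain {x : P | x ∉ T} ∘ₗ s
  have hq : q = 0 := by
    refine hΛ.eq_zero_of_essential_ker inferInstance q (hess.mono fun x hx => ?_)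
    have hx' := hT (Submodule.mem_map_of_mem hx)
    rw [Finsupp.mem_supported'] at hx'
    ext ⟨y, hy⟩
    exact hx' y hy
  refine ⟨⟨T, eq_top_iff.mpr fun x _ => ?_⟩⟩
  have hx : s x ∈ Finsupp.supported Λ Λ (T : Set P) := by
    rw [Finsupp.mem_supported']
    intro y hy
    exact DFunLike.congr_fun (LinearMap.congr_fun hq x) (⟨y, hy⟩ : {x : P // x ∉ T})
  have h1 : Finsupp.linearCombination Λ id (s x) = x := LinearMap.congr_fun hs x
  rw [← h1, ← Set.image_id (T : Set P), Finsupp.mem_span_image_iff_linearCombination]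
  exact ⟨s x, hx, rfl⟩

end Essential

/-! ### Finiteness of independent families -/

section Finiteness

variable {Λ : Type u} [Ring Λ]

variable {E B M : Type u} [AddCommGroup E] [Module Λ E] [AddCommGroup B] [Module Λ B]
  [AddCommGroup M] [Module Λ M]

section Fixed

variable {ι : Type} {e : Set ι → Module.End Λ B}

theorem apply_eq_of_subset (he : ∀ A C, e A ∘ₗ e C = e (A ∩ C)) {A C : Set ι}
    (h : A ⊆ C) {x : B} (hx : e A x = x) : e C x = x := by
  have := LinearMap.congr_fun (he C A) x
  rwa [LinearMap.comp_apply, hx, Set.inter_eq_self_of_subset_right h, hx] at this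

variable (he : ∀ A C, e A ∘ₗ e C = e (A ∩ C))

/-- Let `e A` be commuting idempotent endomorphisms, indexed by sets so that products correspond
to intersections. For an ideal `𝒥` of sets this is the union of the submodules `range (e A)`,
`A ∈ 𝒥`. -/
def fixedBy (𝒥 : Order.Ideal (Set ι)) : Submodule Λ B where
  carrier := {x | ∃ A ∈ 𝒥, e A x = x}
  add_mem' := by
    rintro x y ⟨A, hA, hx⟩ ⟨C, hC, hy⟩
    exact ⟨A ∪ C, Order.Ideal.sup_mem hA hC, by
      rw [map_add, apply_eq_of_subset he Set.subset_union_left hx,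
        apply_eq_of_subset he Set.subset_union_right hy]⟩
  zero_mem' := by
    obtain ⟨A, hA⟩ := 𝒥.nonempty
    exact ⟨A, hA, map_zero _⟩
  smul_mem' := by
    rintro r x ⟨A, hA, hx⟩
    exact ⟨A, hA, by rw [map_smul, hx]⟩

theorem apply_mem_fixedBy {𝒥 : Order.Ideal (Set ι)} {A : Set ι} (hA : A ∈ 𝒥) (x : B) :
    e A x ∈ fixedBy he 𝒥 :=
  ⟨A, hA, by simpa using LinearMap.congr_fun (he A A) x⟩

theorem exists_comp_eq_of_range_le_fixedBy {𝒥 : Order.Ideal (Set ι)} [Module.Finite Λ M]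
    (g : M →ₗ[Λ] B) (hg : ∀ x, g x ∈ fixedBy he 𝒥) : ∃ A ∈ 𝒥, e A ∘ₗ g = g := by
  suffices h : ∀ N : Submodule Λ M, N.FG → ∃ A ∈ 𝒥, ∀ x ∈ N, e A (g x) = g x by
    obtain ⟨A, hA, h⟩ := h ⊤ Module.Finite.fg_top
    exact ⟨A, hA, LinearMap.ext fun x => h x trivial⟩
  intro N hN
  induction N, hN using Submodule.fg_induction with
  | singleton x =>
    obtain ⟨A, hA, h⟩ := hg x
    refine ⟨A, hA, fun y hy => ?_⟩
    obtain ⟨r, rfl⟩ := Submodule.mem_span_singleton.mp hy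
    simp only [map_smul, h]
  | sup N₁ N₂ _ _ h₁ h₂ =>
    obtain ⟨A, hA, h₁⟩ := h₁
    obtain ⟨C, hC, h₂⟩ := h₂
    refine ⟨A ∪ C, Order.Ideal.sup_mem hA hC, fun y hy => ?_⟩
    obtain ⟨a, ha, c, hc, rfl⟩ := Submodule.mem_sup.mp hy
    rw [map_add, map_add, apply_eq_of_subset he Set.subset_union_left (h₁ a ha),
      apply_eq_of_subset he Set.subset_union_right (h₂ c hc)]

end Fixed

/-- The homomorphism `N₁ + N₂ → B / W` which is the projection on `N₁` and zero on `N₂` extends to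
`B`, as `B / W` is injective, and then lifts to `B`, as `B` is projective. -/
theorem IsLeftHereditary.exists_end_separating (hΛ : IsLeftHereditary Λ)
    (hB : Module.Injective Λ B) (hB' : Module.Projective Λ B) {N₁ N₂ W : Submodule Λ B}
    (h : N₁ ⊓ N₂ ≤ W) :
    ∃ m : Module.End Λ B, (∀ x ∈ N₁, m x - x ∈ W) ∧ ∀ x ∈ N₂, m x ∈ W := by
  let f₁ : B →ₗ.[Λ] B ⧸ W := ⟨N₁, W.mkQ ∘ₗ N₁.subtype⟩
  let f₂ : B →ₗ.[Λ] B ⧸ W := ⟨N₂, 0⟩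
  have hf : ∀ (x : f₁.domain) (y : f₂.domain), (x : B) = y → f₁ x = f₂ y := by
    rintro ⟨x, hx⟩ ⟨y, hy⟩ rfl
    exact (Submodule.Quotient.mk_eq_zero W).mpr (h ⟨hx, hy⟩)
  obtain ⟨ψ, hψ⟩ := (hΛ.injective_of_surjective hB W.mkQ W.mkQ_surjective).out
    (f₁.sup f₂ hf).domain.subtype Subtype.val_injective (f₁.sup f₂ hf).toFun
  obtain ⟨m, hm⟩ := Module.projective_lifting_property W.mkQ ψ W.mkQ_surjective
  have hm' : ∀ x, W.mkQ (m x) = ψ x := LinearMap.congr_fun hm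
  refine ⟨m, fun x hx => ?_, fun x hx => ?_⟩
  · rw [← Submodule.Quotient.mk_eq_zero W]
    have h₁ := (f₁.left_le_sup f₂ hf).2 (x := ⟨x, hx⟩)
      (y := ⟨x, (f₁.left_le_sup f₂ hf).1 hx⟩) rfl
    have h₂ := hψ ⟨x, (f₁.left_le_sup f₂ hf).1 hx⟩
    rw [Submodule.Quotient.mk_sub, sub_eq_zero]
    exact (hm' x).trans (h₂.trans h₁.symm)
  · rw [← Submodule.Quotient.mk_eq_zero W]
    have h₁ := (f₁.right_le_sup f₂ hf).2 (x := ⟨x, hx⟩)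
      (y := ⟨x, (f₁.right_le_sup f₂ hf).1 hx⟩) rfl
    have h₂ := hψ ⟨x, (f₁.right_le_sup f₂ hf).1 hx⟩
    exact (hm' x).trans (h₂.trans h₁.symm)

/-- The ideal of finite sets. -/
def finiteSets (ι : Type) : Order.Ideal (Set ι) where
  carrier := {A | A.Finite}
  lower' := fun _ _ h hA => Set.Finite.subset hA h
  nonempty' := ⟨∅, Set.finite_empty⟩
  directed' := fun A hA C hC => ⟨A ∪ C, Set.Finite.union hA hC, Set.subset_union_left,
    Set.subset_union_right⟩

/-- The ideal of subsets of `ℕ × ℕ` contained in finitely many columns `{k} × ℕ`. -/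
def boundedColumns : Order.Ideal (Set (ℕ × ℕ)) where
  carrier := {A | ∃ K, ∀ n ∈ A, n.1 < K}
  lower' := fun _ _ h ⟨K, hK⟩ => ⟨K, fun n hn => hK n (h hn)⟩
  nonempty' := ⟨∅, 0, by simp⟩
  directed' := fun A ⟨K, hK⟩ C ⟨L, hL⟩ => ⟨A ∪ C, ⟨max K L, by
    rintro n (hn | hn)
    · exact (hK n hn).trans_le (le_max_left _ _)
    · exact (hL n hn).trans_le (le_max_right _ _)⟩, Set.subset_union_left,
    Set.subset_union_right⟩

/-- The ideal of subsets of `ℕ × ℕ` that meet every column `{k} × ℕ` in a finite set. -/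
def finiteColumns : Order.Ideal (Set (ℕ × ℕ)) where
  carrier := {A | ∀ k, {n ∈ A | n.1 = k}.Finite}
  lower' := fun _ _ h hA k => (hA k).subset fun _ hn => ⟨h hn.1, hn.2⟩
  nonempty' := ⟨∅, by simp⟩
  directed' := fun A hA C hC => ⟨A ∪ C, fun k => ((hA k).union (hC k)).subset (by
    rintro n ⟨hn | hn, h⟩
    exacts [Or.inl ⟨hn, h⟩, Or.inr ⟨hn, h⟩]), Set.subset_union_left, Set.subset_union_right⟩

theorem finite_inter_of_mem_columns {A C : Set (ℕ × ℕ)} (hA : A ∈ boundedColumns)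
    (hC : C ∈ finiteColumns) :
    (A ∩ C).Finite := by
  obtain ⟨K, hK⟩ := hA
  refine ((Set.finite_Iio K).biUnion fun k _ => hC k).subset fun n hn => ?_
  exact Set.mem_biUnion (x := n.1) (hK n hn.1) ⟨hn.2, rfl⟩

/-- A diagonal argument in the style of Osofsky. Take an endomorphism `m` that is, modulo the
finite part, the identity on the columns and zero on the graphs of all functions `ℕ → ℕ`.
Finite generation makes `m` agree with the identity on almost every entry of each
column. A graph through such entries is then not killed modulo the finite part. -/
theorem IsLeftHereditary.false_of_idempotents (hΛ : IsLeftHereditary Λ)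
    (hB : Module.Injective Λ B) (hB' : Module.Projective Λ B) [Module.Finite Λ B]
    (e : Set (ℕ × ℕ) → Module.End Λ B) (he : ∀ A C, e A ∘ₗ e C = e (A ∩ C)) (h₀ : e ∅ = 0)
    (hne : ∀ n, e {n} ≠ 0) : False := by
  have he' : ∀ A C x, e A (e C x) = e (A ∩ C) x := fun A C x => LinearMap.congr_fun (he A C) x
  obtain ⟨m, hm₁, hm₂⟩ := hΛ.exists_end_separating hB hB'
    (N₁ := fixedBy he boundedColumns) (N₂ := fixedBy he finiteColumns)
    (W := fixedBy he (finiteSets _)) (by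
      rintro x ⟨⟨A, hA, hx⟩, ⟨C, hC, hx'⟩⟩
      exact ⟨A ∩ C, finite_inter_of_mem_columns hA hC, by rw [← he', hx', hx]⟩)
  have hcol : ∀ k, ∃ D : Set (ℕ × ℕ), D.Finite ∧
      e D ∘ₗ ((m - LinearMap.id) ∘ₗ e {n | n.1 = k}) = (m - LinearMap.id) ∘ₗ e {n | n.1 = k} :=
    fun k => exists_comp_eq_of_range_le_fixedBy he (𝒥 := finiteSets _) _ fun x =>
      hm₁ _ (apply_mem_fixedBy he (𝒥 := boundedColumns) ⟨k + 1, fun n hn => by simp_all⟩ x)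
  choose D hD hDm using hcol
  have hg : ∀ k, ∃ l, (k, l) ∉ D k := fun k => by
    by_contra! h
    exact Set.infinite_univ (((hD k).preimage (Prod.mk_right_injective k).injOn).subset
      fun l _ => h l)
  choose g hg using hg
  let G : Set (ℕ × ℕ) := Set.range fun k => (k, g k)
  obtain ⟨D', hD', hDm'⟩ := exists_comp_eq_of_range_le_fixedBy he (𝒥 := finiteSets _)
    (m ∘ₗ e G) fun x => hm₂ _ (apply_mem_fixedBy he (𝒥 := finiteColumns)
      (fun k => (Set.finite_singleton (k, g k)).subset (by rintro _ ⟨⟨j, rfl⟩, rfl⟩; rfl)) x)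
  obtain ⟨k, hk⟩ : ∃ k, (k, g k) ∉ D' := by
    by_contra! h
    exact Set.infinite_univ ((Set.Finite.preimage
      (fun a _ b _ hab => congrArg Prod.fst hab : Set.InjOn (fun k => (k, g k)) _) hD').subset
        fun k _ => h k)
  refine hne (k, g k) (LinearMap.ext fun x => ?_)
  have hdis : ∀ {A : Set (ℕ × ℕ)}, (k, g k) ∉ A → ∀ y, e {(k, g k)} (e A y) = 0 := fun hA y => by
    rw [he', Set.singleton_inter_eq_empty.mpr hA, h₀, LinearMap.zero_apply]
  -- both identities are evaluated at `e {(k, g k)} x`, in the component of `(k, g k)`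
  have h₁ := congrArg (e {(k, g k)}) (LinearMap.congr_fun (hDm k) (e {(k, g k)} x))
  have h₂ := congrArg (e {(k, g k)}) (LinearMap.congr_fun hDm' (e {(k, g k)} x))
  have hc : {n : ℕ × ℕ | n.1 = k} ∩ {(k, g k)} = {(k, g k)} :=
    Set.inter_eq_right.mpr (by simp)
  have hG : G ∩ {(k, g k)} = {(k, g k)} := Set.inter_eq_right.mpr (by simp [G])
  simp only [LinearMap.comp_apply, he' {n : ℕ × ℕ | n.1 = k}, hc, hdis (hg k)] at h₁
  simp only [LinearMap.comp_apply, he' G, hG, hdis hk] at h₂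
  simp only [LinearMap.sub_apply, LinearMap.id_apply, map_sub, ← h₂, he', Set.inter_self,
    zero_sub] at h₁
  simpa using h₁

/-- A finitely generated projective injective module over a left hereditary ring contains no
infinite independent family of nonzero submodules `v n`. Replacing `E` by the envelope of the
direct sum, which is both a quotient and a submodule of `E`, the projections of the direct
sum extend to idempotents of the envelope. -/
theorem IsLeftHereditary.false_of_iSupIndep (hΛ : IsLeftHereditary Λ)
    (hE : Module.Injective Λ E) (hE' : Module.Projective Λ E) [Module.Finite Λ E]
    (v : ℕ × ℕ → Submodule Λ E) (hv : iSupIndep v) (hne : ∀ n, v n ≠ ⊥) : False := by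
  classical
  let i : (Π₀ n, v n) →ₗ[Λ] E := DFinsupp.lsum ℕ fun n => (v n).subtype
  have hi : Function.Injective i := hv.dfinsupp_lsum_injective
  obtain ⟨C, hinj, hess⟩ := exists_essential_quotient i hi
  set j := C.mkQ ∘ₗ i with hj
  have hB := hΛ.injective_of_surjective hE C.mkQ C.mkQ_surjective
  obtain ⟨r, hr⟩ := hE.out j hinj i
  have hB' : Module.Projective Λ (E ⧸ C) := hΛ.projective_of_injective hE' r
    (hess.injective_of_comp (by rwa [show r ∘ₗ j = i from LinearMap.ext hr]))
  have huniq : ∀ f g : Module.End Λ (E ⧸ C), (∀ x, f (j x) = g (j x)) → f = g := fun f g h => by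
    rw [← sub_eq_zero]
    refine hΛ.eq_zero_of_essential_ker hB' _ (hess.mono ?_)
    rintro _ ⟨x, rfl⟩
    simp [h]
  have hex : ∀ A : Set (ℕ × ℕ), ∃ f : Module.End Λ (E ⧸ C),
      ∀ x, f (j x) = j (DFinsupp.filterLinearMap Λ (fun n => v n) (· ∈ A) x) := fun A =>
    hB.out j hinj (j ∘ₗ DFinsupp.filterLinearMap Λ (fun n => v n) (· ∈ A))
  choose e he using hex
  refine hΛ.false_of_idempotents hB hB' e (fun A C => huniq _ _ fun x => ?_)
    (huniq _ _ fun x => ?_) fun n h => ?_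
  · rw [LinearMap.comp_apply, he, he, he]
    congr 1
    ext n : 1
    by_cases h₁ : n ∈ A <;> by_cases h₂ : n ∈ C <;> simp [DFinsupp.filter_apply, h₁, h₂]
  · rw [he, LinearMap.zero_apply, map_eq_zero_iff j hinj]
    ext n : 1
    simp [DFinsupp.filter_apply]
  · obtain ⟨y, hy, hy0⟩ := (Submodule.ne_bot_iff _).mp (hne n)
    have h₁ := he {n} (DFinsupp.single n ⟨y, hy⟩)
    rw [h, LinearMap.zero_apply, eq_comm, map_eq_zero_iff j hinj] at h₁
    have h₂ := DFunLike.congr_fun h₁ n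
    exact hy0 (by simpa using h₂)

theorem iSupIndep_of_nat {v N : ℕ → Submodule Λ M} (hN : Monotone N)
    (hvN : ∀ n, v n ≤ N (n + 1)) (hdis : ∀ n, Disjoint (v n) (N n)) : iSupIndep v := by
  rw [iSupIndep_iff_finsetSum_eq_zero_imp_eq_zero]
  intro s
  induction s using Finset.induction_on_max with
  | empty => simp
  | insert a s ha ih =>
    intro w hw hsum
    have hnot : a ∉ s := fun h => lt_irrefl _ (ha a h)
    rw [Finset.sum_insert hnot] at hsum
    have hmem : ∑ i ∈ s, w i ∈ N a := Submodule.sum_mem _ fun i hi =>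
      hN (ha i hi) (hvN i (hw i (Finset.mem_insert_of_mem hi)))
    have hwa : w a = 0 := Submodule.disjoint_def.mp (hdis a) _ (hw a (Finset.mem_insert_self _ _))
      (by rw [eq_neg_of_add_eq_zero_left hsum]; exact neg_mem hmem)
    rw [hwa, zero_add] at hsum
    have := ih w (fun i hi => hw i (Finset.mem_insert_of_mem hi)) hsum
    simpa [hwa] using this

/-- A left ideal that is not finitely generated has no finitely generated essential submodule, so
it contains an infinite direct sum of nonzero cyclic left ideals. -/
theorem IsLeftHereditary.exists_iSupIndep (hΛ : IsLeftHereditary Λ) (J : Ideal Λ) (hJ : ¬ J.FG) :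
    ∃ v : ℕ → Submodule Λ J, iSupIndep v ∧ ∀ n, v n ≠ ⊥ := by
  have hstep : ∀ N : {N : Submodule Λ J // N.FG}, ∃ x : J, x ≠ 0 ∧
      Disjoint (Submodule.span Λ {x}) N.1 := by
    rintro ⟨N, hN⟩
    by_contra! h
    refine hJ ?_
    have := hΛ.finite_of_essential_fg (hΛ J) N hN fun N' hN' => ?_
    · exact Module.Finite.iff_fg.mp this
    · by_contra hne
      obtain ⟨x, hx, hx0⟩ := (Submodule.ne_bot_iff _).mp hne
      exact h x hx0 ((disjoint_iff.mpr hN').mono_left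
        ((Submodule.span_singleton_le_iff_mem _ _).mpr hx))
  choose c hc hdis using hstep
  let N : ℕ → {N : Submodule Λ J // N.FG} := fun n => Nat.rec ⟨⊥, Submodule.fg_bot⟩
    (fun _ N => ⟨N.1 ⊔ Submodule.span Λ {c N}, N.2.sup (Submodule.fg_span_singleton _)⟩) n
  refine ⟨fun n => Submodule.span Λ {c (N n)}, iSupIndep_of_nat (N := fun n => (N n).1)
    (monotone_nat_of_le_succ fun n => ?_) (fun n => ?_) fun n => hdis (N n), fun n => ?_⟩
  · exact le_sup_left (a := (N n).1) (b := Submodule.span Λ {c (N n)})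
  · exact le_sup_right (a := (N n).1) (b := Submodule.span Λ {c (N n)})
  · simpa using hc (N n)

/-- The envelope is finitely generated, as `Λ` is an essential submodule of it. -/
theorem IsLeftHereditary.isNoetherianRing (hΛ : IsLeftHereditary Λ) (i : Λ →ₗ[Λ] E)
    (hi : IsInjectiveEnvelope i) (hE : Module.Projective Λ E) : IsNoetherianRing Λ := by
  have : Module.Finite Λ E := hΛ.finite_of_essential_fg hE (LinearMap.range i)
    (by rw [LinearMap.range_eq_map]; exact Module.Finite.fg_top.map i) hi.essential
  refine (isNoetherianRing_iff_ideal_fg Λ).mpr fun J => ?_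
  by_contra hJ
  obtain ⟨v, hv, hne⟩ := hΛ.exists_iSupIndep J hJ
  have hinj : Function.Injective (i ∘ₗ J.subtype) := hi.injective_map.comp Subtype.val_injective
  have hv' : iSupIndep fun n => (v n).map (i ∘ₗ J.subtype) := LinearMap.iSupIndep_map _ hinj hv
  refine hΛ.false_of_iSupIndep hi.injective_module hE
    (fun n => (v (Nat.pairEquiv n)).map (i ∘ₗ J.subtype)) (hv'.comp Nat.pairEquiv.injective)
    fun n h => hne (Nat.pairEquiv n) ?_
  exact Submodule.map_injective_of_injective hinj (by rw [h, Submodule.map_bot])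

/-- Baer's criterion: a homomorphism from a finitely generated left ideal involves only finitely
many coordinates. -/
theorem injective_finsupp [IsNoetherianRing Λ] (hE : Module.Injective Λ E) (ι : Type u) :
    Module.Injective Λ (ι →₀ E) := by
  refine Module.Baer.injective fun J g => ?_
  obtain ⟨T, hT⟩ := exists_finset_le_supported (LinearMap.range g)
    (by rw [LinearMap.range_eq_map]; exact Module.Finite.fg_top.map g)
  have hex := fun s : ι => Module.Baer.of_injective hE J (Finsupp.lapply s ∘ₗ g)
  choose h hh using hex
  refine ⟨∑ s ∈ T, Finsupp.lsingle s ∘ₗ h s, fun x hx => ?_⟩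
  have hg := hT ⟨⟨x, hx⟩, rfl⟩
  rw [Finsupp.mem_supported] at hg
  rw [← Finsupp.sum_single (g ⟨x, hx⟩), Finsupp.sum_of_support_subset _ hg _ (by simp)]
  simp [hh _ x hx]

theorem IsLeftHereditary.exists_projective_injective_extension (hΛ : IsLeftHereditary Λ)
    (i : Λ →ₗ[Λ] E) (hi : IsInjectiveEnvelope i) (hE : Module.Projective Λ E)
    (K : Type u) [AddCommGroup K] [Module Λ K] (hK : Module.Projective Λ K) :
    ∃ (Q : ModuleCat.{u} Λ) (j : K →ₗ[Λ] Q), Function.Injective j ∧ Module.Injective Λ Q ∧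
      Module.Projective Λ Q := by
  have := hΛ.isNoetherianRing i hi hE
  obtain ⟨s, hs⟩ := Module.projective_def'.mp hK
  refine ⟨ModuleCat.of Λ (K →₀ E), Finsupp.mapRange.linearMap i ∘ₗ s, ?_,
    injective_finsupp hi.injective_module K, ?_⟩
  · exact (Finsupp.mapRange_injective i (map_zero i) hi.injective_map).comp
      (LinearMap.injective_of_comp_eq_id _ _ hs)
  · classical
    exact Module.Projective.of_equiv (M := Π₀ _ : K, E) (finsuppLequivDFinsupp Λ).symm

end Finiteness

/-! ### Monomorphisms of the stable category -/

section Stable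

variable {Λ : Type u} [Ring Λ]

theorem FactorsThroughProjective.of_projective_right {A B P : ModuleCat.{u} Λ}
    (hP : Module.Projective Λ P) (g : A ⟶ P) (h : P ⟶ B) :
    FactorsThroughProjective Λ (g ≫ h) :=
  ⟨P, hP, g, h, rfl⟩

theorem FactorsThroughProjective.exists_lift {A B C : ModuleCat.{u} Λ} {f : A ⟶ B}
    (hf : FactorsThroughProjective Λ f) (p : C ⟶ B) (hp : Function.Surjective p) :
    ∃ g : A ⟶ C, g ≫ p = f := by
  obtain ⟨P, hP, g, h, rfl⟩ := hf
  obtain ⟨l, hl⟩ := Module.projective_lifting_property p.hom h.hom hp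
  refine ⟨g ≫ ModuleCat.ofHom l, ?_⟩
  ext x
  exact LinearMap.congr_fun hl (g x)

theorem quotientFunctor_map_eq_iff {A B : ModuleCat.{u} Λ} (f g : A ⟶ B) :
    (quotientFunctor Λ).map f = (quotientFunctor Λ).map g ↔
      FactorsThroughProjective Λ (f - g) :=
  Quotient.functor_map_eq_iff (stableRel Λ) f g

theorem mono_quotientFunctor_map_iff {A B : ModuleCat.{u} Λ} (f : A ⟶ B) :
    Mono ((quotientFunctor Λ).map f) ↔ ∀ (X : ModuleCat.{u} Λ) (g : X ⟶ A),
      FactorsThroughProjective Λ (g ≫ f) → FactorsThroughProjective Λ g := by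
  constructor
  · intro _ X g h
    rw [← quotientFunctor_map_eq_zero_iff, Functor.map_comp] at h
    rw [← quotientFunctor_map_eq_zero_iff]
    exact Limits.zero_of_comp_mono _ h
  · intro H
    refine Preadditive.mono_of_cancel_zero _ ?_
    rintro ⟨X⟩ g hg
    obtain ⟨g, rfl⟩ := (quotientFunctor Λ).map_surjective (X := X) (Y := A) g
    rw [← Functor.map_comp, quotientFunctor_map_eq_zero_iff] at hg
    exact (quotientFunctor_map_eq_zero_iff Λ g).mpr (H X g hg)

theorem exists_projective_surjective (M : ModuleCat.{u} Λ) :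
    ∃ (F : ModuleCat.{u} Λ) (p : F ⟶ M), Module.Projective Λ F ∧ Function.Surjective p :=
  ⟨ModuleCat.of Λ (M →₀ Λ), ModuleCat.ofHom (Finsupp.linearCombination Λ id),
    inferInstanceAs (Module.Projective Λ (M →₀ Λ)), Finsupp.linearCombination_id_surjective Λ M⟩

/-- If `g ≫ π` factors through a projective, it lifts along `π` through that projective, and `g`
differs from the lift by a homomorphism into `P`. -/
theorem mono_mkQ_range {P I : ModuleCat.{u} Λ} (i : P →ₗ[Λ] I) (hP : Module.Projective Λ P)
    (hi : Function.Injective i) :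
    Mono ((quotientFunctor Λ).map (ModuleCat.ofHom (LinearMap.range i).mkQ)) := by
  rw [mono_quotientFunctor_map_iff]
  rintro X g ⟨Q, hQ, a, b, hab⟩
  obtain ⟨l, hl⟩ := Module.projective_lifting_property (LinearMap.range i).mkQ b.hom
    (LinearMap.range i).mkQ_surjective
  let d : X →ₗ[Λ] I := g.hom - l ∘ₗ a.hom
  have hd : ∀ x, d x ∈ LinearMap.range i := fun x => by
    rw [← Submodule.Quotient.mk_eq_zero]
    have h₁ : (LinearMap.range i).mkQ (l (a x)) = b (a x) := LinearMap.congr_fun hl (a x)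
    have h₂ : b (a x) = (LinearMap.range i).mkQ (g x) := ConcreteCategory.congr_hom hab x
    have h₃ := h₂.symm.trans h₁.symm
    simp only [d, LinearMap.sub_apply, LinearMap.comp_apply, Submodule.Quotient.mk_sub]
    exact sub_eq_zero.mpr h₃
  let d' : X →ₗ[Λ] P := (LinearEquiv.ofInjective i hi).symm.toLinearMap ∘ₗ d.codRestrict _ hd
  have hd' : ∀ x, i (d' x) = d x := fun x => congrArg Subtype.val
    ((LinearEquiv.ofInjective i hi).apply_symm_apply (d.codRestrict _ hd x))
  have hg : g = a ≫ ModuleCat.ofHom l + ModuleCat.ofHom d' ≫ ModuleCat.ofHom i := by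
    ext x
    have := hd' x
    simp only [d, LinearMap.sub_apply, LinearMap.comp_apply] at this
    simp [this]
  rw [hg]
  exact .add (.of_projective_right hQ _ _) (.of_projective_right hP _ _)

/-- Suppose that `π : I → I / P` is a kernel of `φ`. Lift `π ≫ φ` to `a : I → F` for a surjection
`F → Z` from a projective, and let `Y` be the pullback of `φ` along it. As `π` is a kernel,
the map `j = (π, a) : I → Y` has a left inverse `h` up to a map `q ≫ r` through a projective `Q`.
On `P`, where `j` is just `a`, this shows that `(a, q) : I → F × Q` is injective. So `(a, q)` is
injective on the essential extension `I` of `P`, and `I` is projective. -/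
theorem IsLeftHereditary.isEmpty_normalMono_mkQ_range (hΛ : IsLeftHereditary Λ)
    {P I : ModuleCat.{u} Λ} (i : P →ₗ[Λ] I) (hP : Module.Projective Λ P)
    (hi : IsInjectiveEnvelope i) (hI : ¬ Module.Projective Λ I) :
    IsEmpty (NormalMono ((quotientFunctor Λ).map (ModuleCat.ofHom (LinearMap.range i).mkQ))) := by
  refine ⟨fun ⟨Z, φ, w, hlim⟩ => hI ?_⟩
  have hmono := mono_mkQ_range i hP hi.injective_map
  obtain ⟨Z⟩ := Z
  obtain ⟨φ, rfl⟩ := (quotientFunctor Λ).map_surjective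
    (X := ModuleCat.of Λ (I ⧸ LinearMap.range i)) (Y := Z) φ
  set π : I ⟶ ModuleCat.of Λ (I ⧸ LinearMap.range i) :=
    ModuleCat.ofHom (LinearMap.range i).mkQ with hπ
  have w' : FactorsThroughProjective Λ (π ≫ φ) := by
    rw [← quotientFunctor_map_eq_zero_iff, Functor.map_comp]
    exact w
  obtain ⟨F, p, hF, hp⟩ := exists_projective_surjective Z
  obtain ⟨a, ha⟩ := w'.exists_lift p hp
  let Ys : Submodule Λ ((I ⧸ LinearMap.range i) × F) :=
    LinearMap.eqLocus (φ.hom ∘ₗ LinearMap.fst Λ _ _) (p.hom ∘ₗ LinearMap.snd Λ _ _)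
  let Y : ModuleCat.{u} Λ := ModuleCat.of Λ Ys
  let y : Y ⟶ ModuleCat.of Λ (I ⧸ LinearMap.range i) :=
    ModuleCat.ofHom (LinearMap.fst Λ _ _ ∘ₗ Ys.subtype)
  let y' : Y ⟶ F := ModuleCat.ofHom (LinearMap.snd Λ _ _ ∘ₗ Ys.subtype)
  have hy : y ≫ φ = y' ≫ p := by
    ext x
    exact x.2
  let j : I ⟶ Y := ModuleCat.ofHom ((π.hom.prod a.hom).codRestrict Ys fun x =>
    (ConcreteCategory.congr_hom ha x).symm)
  obtain ⟨h, hh⟩ := Limits.KernelFork.IsLimit.lift' hlim ((quotientFunctor Λ).map y) (by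
    rw [← Functor.map_comp, quotientFunctor_map_eq_zero_iff, hy]
    exact .of_projective_right hF _ _)
  obtain ⟨h, rfl⟩ := (quotientFunctor Λ).map_surjective (X := Y) (Y := I) h
  have hid : (quotientFunctor Λ).map (𝟙 I) = (quotientFunctor Λ).map (j ≫ h) := by
    rw [← cancel_mono ((quotientFunctor Λ).map π), ← Functor.map_comp, Functor.map_comp,
      Functor.map_comp, Category.assoc]
    refine Eq.trans ?_ (congrArg (fun t => (quotientFunctor Λ).map j ≫ t) hh.symm)
    rw [← Functor.map_comp, Category.id_comp]
    rfl
  rw [quotientFunctor_map_eq_iff] at hid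
  obtain ⟨Q, hQ, q, r, hqr⟩ := hid
  have : Module.Projective Λ F := hF
  have : Module.Projective Λ Q := hQ
  refine hΛ.projective_of_injective (P := F × Q) inferInstance (a.hom.prod q.hom) ?_
  refine IsEssential.injective_of_comp (i := i) hi.essential ?_
  refine (injective_iff_map_eq_zero _).mpr fun x hx => hi.injective_map ?_
  have hax : a (i x) = 0 := congrArg Prod.fst hx
  have hqx : q (i x) = 0 := congrArg Prod.snd hx
  have hjx : j (i x) = 0 := by
    refine Subtype.ext (Prod.ext ?_ hax)
    exact (Submodule.Quotient.mk_eq_zero _).mpr ⟨x, rfl⟩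
  have h₁ : r (q (i x)) = i x - h (j (i x)) := ConcreteCategory.congr_hom hqr (i x)
  rw [hqx, hjx, map_zero, map_zero, sub_zero] at h₁
  rw [← h₁, map_zero]

/-- Let `K ≤ X × F` be the kernel. On `K` the map `f` agrees with `-p`, so `K → X → A` is stably
zero; hence `K → X` factors through a projective `Q`, and `K` embeds in `Q × F`. -/
theorem IsLeftHereditary.projective_ker_coprod (hΛ : IsLeftHereditary Λ) {X A F : ModuleCat.{u} Λ}
    (f : X ⟶ A) (hf : Mono ((quotientFunctor Λ).map f)) (hF : Module.Projective Λ F) (p : F ⟶ A) :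
    Module.Projective Λ (LinearMap.ker (f.hom.coprod p.hom)) := by
  let K := LinearMap.ker (f.hom.coprod p.hom)
  let k₁ : ModuleCat.of Λ K ⟶ X := ModuleCat.ofHom (LinearMap.fst Λ _ _ ∘ₗ K.subtype)
  let k₂ : ModuleCat.of Λ K ⟶ F := ModuleCat.ofHom (LinearMap.snd Λ _ _ ∘ₗ K.subtype)
  have hk : k₁ ≫ f = (-k₂) ≫ p := by
    ext x
    have : f x.1.1 + p x.1.2 = 0 := x.2
    exact (eq_neg_of_add_eq_zero_left this).trans (map_neg p.hom _).symm
  obtain ⟨Q, hQ, q, r, hqr⟩ := (mono_quotientFunctor_map_iff f).mp hf _ k₁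
    (hk ▸ .of_projective_right hF _ _)
  have : Module.Projective Λ F := hF
  have : Module.Projective Λ Q := hQ
  refine hΛ.projective_of_injective (P := Q × F) inferInstance (q.hom.prod k₂.hom) ?_
  refine (injective_iff_map_eq_zero _).mpr fun x hx => ?_
  have h₁ : q x = 0 := congrArg Prod.fst hx
  have h₂ : r (q x) = x.1.1 := ConcreteCategory.congr_hom hqr x
  rw [h₁, map_zero] at h₂
  have h₃ : x.1.2 = 0 := congrArg (fun z : Q × F => z.2) hx
  exact Subtype.ext (Prod.ext h₂.symm h₃)

/-- Replace `f` by a surjection `c : X × F → A` with projective kernel `K`, and extend an embedding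
of `K` into a projective injective `Q` to `t : X × F → Q`. Then `(c, t)` identifies `X × F` with
the pullback of `Q → Q / t(K)` along the induced map `φ : A → Q / t(K)`, and this makes `f` a
kernel of `φ` in the stable category. -/
theorem IsLeftHereditary.nonempty_normalMono (hΛ : IsLeftHereditary Λ) {E : ModuleCat.{u} Λ}
    (i : Λ →ₗ[Λ] E) (hi : IsInjectiveEnvelope i) (hE : Module.Projective Λ E)
    {X A : ModuleCat.{u} Λ} (f : X ⟶ A) (hf : Mono ((quotientFunctor Λ).map f)) :
    Nonempty (NormalMono ((quotientFunctor Λ).map f)) := by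
  obtain ⟨F, p, hF, hp⟩ := exists_projective_surjective A
  let c : (X × F) →ₗ[Λ] A := f.hom.coprod p.hom
  have hc : Function.Surjective c := fun x => by
    obtain ⟨y, hy⟩ := hp x
    exact ⟨(0, y), by simpa [c] using hy⟩
  let K := LinearMap.ker c
  obtain ⟨Q, s, hs, hQ, hQ'⟩ := hΛ.exists_projective_injective_extension i hi hE K
    (hΛ.projective_ker_coprod f hf hF p)
  obtain ⟨t, ht⟩ := hQ.out K.subtype Subtype.val_injective s
  let N : Submodule Λ Q := K.map t
  let φ : A →ₗ[Λ] Q ⧸ N := (Submodule.mapQ K N t (Submodule.le_comap_map _ _)) ∘ₗ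
    (c.quotKerEquivOfSurjective hc).symm.toLinearMap
  have hφ : ∀ z, φ (c z) = N.mkQ (t z) := fun z => by
    have : (c.quotKerEquivOfSurjective hc).symm (c z) = K.mkQ z := by
      rw [LinearEquiv.symm_apply_eq]; rfl
    simp only [φ, LinearMap.comp_apply, LinearEquiv.coe_coe, this]
    rfl
  have hinj : Function.Injective (c.prod t) := by
    refine (injective_iff_map_eq_zero _).mpr fun z hz => ?_
    have h₁ : z ∈ K := congrArg Prod.fst hz
    have h₂ : t z = 0 := congrArg Prod.snd hz
    have h₃ : s ⟨z, h₁⟩ = 0 := (ht ⟨z, h₁⟩).symm.trans h₂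
    exact congrArg Subtype.val ((map_eq_zero_iff s hs).mp h₃)
  have hrange : ∀ (x : A) (q : Q), φ x = N.mkQ q → (x, q) ∈ LinearMap.range (c.prod t) :=
    fun x q hxq => by
      obtain ⟨z, rfl⟩ := hc x
      rw [hφ, ← sub_eq_zero, ← map_sub] at hxq
      obtain ⟨k, hk, hk'⟩ := (Submodule.Quotient.mk_eq_zero N).mp hxq
      refine ⟨z - k, Prod.ext ?_ ?_⟩
      · simp [LinearMap.mem_ker.mp hk]
      · simp [hk']
  have w : (quotientFunctor Λ).map f ≫ (quotientFunctor Λ).map (ModuleCat.ofHom φ) = 0 := by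
    rw [← Functor.map_comp, quotientFunctor_map_eq_zero_iff]
    refine ⟨Q, hQ', ModuleCat.ofHom (t ∘ₗ LinearMap.inl Λ X F), ModuleCat.ofHom N.mkQ, ?_⟩
    ext x
    have := hφ (x, 0)
    simp only [c, LinearMap.coprod_apply, map_zero, add_zero] at this
    exact this.symm
  have hlift : ∀ {W : StableCategory Λ} (g : W ⟶ (quotientFunctor Λ).obj A),
      g ≫ (quotientFunctor Λ).map (ModuleCat.ofHom φ) = 0 →
        ∃ l : W ⟶ (quotientFunctor Λ).obj X, l ≫ (quotientFunctor Λ).map f = g := by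
    rintro ⟨W⟩ g hg
    obtain ⟨g, rfl⟩ := (quotientFunctor Λ).map_surjective (X := W) (Y := A) g
    rw [← Functor.map_comp, quotientFunctor_map_eq_zero_iff] at hg
    obtain ⟨b, hb⟩ := hg.exists_lift (ModuleCat.ofHom N.mkQ) N.mkQ_surjective
    have hmem : ∀ x, g.hom.prod b.hom x ∈ LinearMap.range (c.prod t) := fun x =>
      hrange _ _ (ConcreteCategory.congr_hom hb x).symm
    let l : W →ₗ[Λ] X × F := (LinearEquiv.ofInjective _ hinj).symm.toLinearMap ∘ₗ
      (g.hom.prod b.hom).codRestrict _ hmem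
    have hl : ∀ x, c (l x) = g x := fun x => congrArg (fun z => z.1.1)
      ((LinearEquiv.ofInjective _ hinj).apply_symm_apply
        ((g.hom.prod b.hom).codRestrict _ hmem x))
    refine ⟨(quotientFunctor Λ).map (ModuleCat.ofHom (LinearMap.fst Λ _ _ ∘ₗ l)), ?_⟩
    rw [← Functor.map_comp, quotientFunctor_map_eq_iff]
    refine ⟨F, hF, ModuleCat.ofHom (-(LinearMap.snd Λ _ _ ∘ₗ l)), p, ?_⟩
    ext x
    have h₁ : f (l x).1 + p (l x).2 = g x := hl x
    have h₂ : p (-(l x).2) = f (l x).1 - g x := by rw [← h₁, map_neg]; abel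
    exact h₂
  choose l hl using @hlift
  exact ⟨⟨_, _, w, Limits.KernelFork.IsLimit.ofι _ _ l hl fun g hg m hm => by
    rw [← cancel_mono ((quotientFunctor Λ).map f), hm, hl]⟩⟩

end Stable

end StableModule

/-- `IsNormalMonoCategory` says that every monomorphism is a kernel of some morphism, and
`NormalMono f` is the data of a morphism of which `f` is a kernel. -/
theorem theorem7p4 (Λ : Type u) [Ring Λ] (hΛ : StableModule.IsLeftHereditary Λ) :
    (IsNormalMonoCategory (StableModule.StableCategory Λ) ↔
      ∃ (E : ModuleCat.{u} Λ) (i : Λ →ₗ[Λ] E),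
        StableModule.IsInjectiveEnvelope i ∧ Module.Projective Λ E) ∧
    (∀ (P I : ModuleCat.{u} Λ) (i : P →ₗ[Λ] I), Module.Projective Λ P →
      StableModule.IsInjectiveEnvelope i → ¬ Module.Projective Λ I →
        Mono ((StableModule.quotientFunctor Λ).map
          (ModuleCat.ofHom (LinearMap.range i).mkQ)) ∧
        IsEmpty (NormalMono ((StableModule.quotientFunctor Λ).map
          (ModuleCat.ofHom (LinearMap.range i).mkQ)))) := by
  refine ⟨⟨fun h => ?_, fun ⟨E, i, hi, hE⟩ => ⟨fun {X Y} f hf => ?_⟩⟩,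
    fun P I i hP hi hI => ⟨StableModule.mono_mkQ_range i hP hi.injective_map,
      hΛ.isEmpty_normalMono_mkQ_range i hP hi hI⟩⟩
  · obtain ⟨E, i, hi⟩ := hΛ.exists_isInjectiveEnvelope Λ
    refine ⟨E, i, hi, ?_⟩
    by_contra hE
    let i' : ModuleCat.of Λ Λ →ₗ[Λ] E := i
    have hP : Module.Projective Λ (ModuleCat.of Λ Λ) := inferInstanceAs (Module.Projective Λ Λ)
    have := StableModule.mono_mkQ_range i' hP hi.injective_map
    exact (hΛ.isEmpty_normalMono_mkQ_range i' hP hi hE).false (h.normalMonoOfMono _).some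
  · obtain ⟨X⟩ := X
    obtain ⟨Y⟩ := Y
    obtain ⟨f, rfl⟩ := (StableModule.quotientFunctor Λ).map_surjective (X := X) (Y := Y) f
    exact hΛ.nonempty_normalMono i hi hE f hf
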